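/- For real $(j,h)$ let $P(x)=2(h-x)(1-x^2)-j^2$, where $j$ is the angular momentum and $h$ the energy of the spherical pendulum. For $(j,h)\neq(0,1)$ near the critical value $(0,1)$, let $x^-<x^+<x^0$ be the roots of $P$, and put $$T=2\int_{x^-}^{x^+}\frac{dx}{\sqrt{P(x)}},\qquad \Theta=\frac{1}{2\pi}\,2j\int_{x^-}^{x^+}\frac{dx}{(1-x^2)\sqrt{P(x)}}\quad(j\neq 0),\qquad \tau=-\Theta+iT .$$ Here $\Theta$ is the rotation number, measured in full turns. A branch of $\Theta$ along a curve is a continuous function that differs from $\Theta$ by an integer at every parameter with $j\ne0$. A lattice vector transported along a curve is a continuous complex-valued function whose value lies in $\mathbb Z+\mathbb Z\tau$ at every parameter with $j\neq0$. There is $\varepsilon_0>0$ such that $T$ is a continuous (single-valued) function on the punctured disc $0<j^2+(h-1)^2<\varepsilon_0^2$, and such that for every $0<\varepsilon<\varepsilon_0$ the following hold on the circuit $j=\varepsilon\cos t$, $h=1+\varepsilon\sin t$, $0\le t\le 2\pi$. 1. $P$ has three distinct real roots with $-1\le x^-<x^+\le1\le x^0$, $x^+<x^0$, and $P(x)=2(x-x^-)(x-x^+)(x-x^0)$.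 The integral for $T$ converges and $T>0$; the integral for $\Theta$ converges if $j\ne0$. 2. $T$ varies continuously along the circuit and returns to its initial value. 3. The function $\Theta$ given by the integral is continuous along the circuit where $j\neq0$. It jumps from $1$ to $-1$ at $t=\pi/2$ and from $-\tfrac12$ to $\tfrac12$ at $t=3\pi/2$, so its jumps along the circuit add up to $-1$. 4. Along the circuit taken with the positive orientation of the $(h,j)$-plane, that is $j=\varepsilon\cos t$, $h=1-\varepsilon\sin t$, a branch of $\Theta$ with initial value $\Theta(\varepsilon,1)$ exists, and the variation of every branch from $t=0$ to $t=2\pi$ equals $-1$. Run in the opposite direction $j=\varepsilon\cos t$, $h=1+\varepsilon\sin t$, a branch with the same initial value exists, and every branch varies by $+1$. 5. (Monodromy.) Along $j=\varepsilon\cos t$, $h=1-\varepsilon\sin t$, $0\le t\le2\pi$, every vector $m_0+m_1\tau$ ($m_0,m_1\in\mathbb Z$) of the lattice $\mathbb Z+\mathbb Z\tau$ at $(j,h)=(\varepsilon,1)$ can be transported, and every such transport ends at $m_0'+m_1'\tau$ with $\begin{pmatrix}m_0'\\ m_1'\end{pmatrix}=\begin{pmatrix}1&1\\0&1\end{pmatrix}\begin{pmatrix}m_0\\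 m_1\end{pmatrix}$. That is, the basis $(1,\tau)$ returns as $(1,\tau+1)$. -/

import Mathlib

open scoped Matrix Topology

noncomputable section

namespace SphericalPendulum

/-- The polynomial `P(x) = 2(h - x)(1 - x²) - j²`; the pair `p = (j, h)` consists of the angular
momentum `j = p.1` and the energy `h = p.2`. -/
def P (p : ℝ × ℝ) (x : ℝ) : ℝ := 2 * (p.2 - x) * (1 - x ^ 2) - p.1 ^ 2

/-- The smallest real root `x⁻` of `P`. -/
def xMinus (p : ℝ × ℝ) : ℝ := sInf {x | P p x = 0}

/-- The second real root `x⁺` of `P`. -/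
def xPlus (p : ℝ × ℝ) : ℝ := sInf {x | xMinus p < x ∧ P p x = 0}

/-- The third real root `x⁰` of `P`. -/
def xZero (p : ℝ × ℝ) : ℝ := sInf {x | xPlus p < x ∧ P p x = 0}

/-- The first return time `T = 2 ∫ dx / √P(x)`, the integral running from `x⁻` to `x⁺`. -/
def returnTime (p : ℝ × ℝ) : ℝ :=
  2 * ∫ x in (xMinus p)..(xPlus p), 1 / √(P p x)

/-- The rotation number in full turns,
`Θ = (1 / 2π) · 2j ∫ dx / ((1 - x²) √P(x))`, the integral running from `x⁻` to `x⁺`.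
It is meaningful for `j ≠ 0`; for `j = 0` the integral diverges, and the value is never used. -/
def rotationNumber (p : ℝ × ℝ) : ℝ :=
  1 / (2 * Real.pi) *
    (2 * p.1 * ∫ x in (xMinus p)..(xPlus p), 1 / ((1 - x ^ 2) * √(P p x)))

/-- `τ = -Θ + i T`. -/
def tau (p : ℝ × ℝ) : ℂ := -(rotationNumber p : ℂ) + Complex.I * (returnTime p : ℂ)

/-- The lattice `ℤ + ℤ τ`. -/
def periodLattice (p : ℝ × ℝ) : AddSubgroup ℂ := AddSubgroup.closure {1, tau p}

/-- The circuit `j = ε cos t`, `h = 1 + ε sin t` around the critical value `(0, 1)`. -/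
def circuit (ε t : ℝ) : ℝ × ℝ := (ε * Real.cos t, 1 + ε * Real.sin t)

/-- The same circuit run in the opposite sense, `j = ε cos t`, `h = 1 - ε sin t`. -/
def reversedCircuit (ε t : ℝ) : ℝ × ℝ := circuit ε (-t)

/-- `θ` is a continuous determination of the rotation number (which is defined up to integers)
along the curve `c`. -/
def IsRotationBranch (c : ℝ → ℝ × ℝ) (θ : ℝ → ℝ) : Prop :=
  Continuous θ ∧ ∀ t, (c t).1 ≠ 0 → ∃ n : ℤ, θ t = rotationNumber (c t) + n

/-- `u` is a continuous choice of lattice vectors along the curve `c`, that is, a lattice vector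
transported in parallel along `c`. -/
def IsLatticeTransport (c : ℝ → ℝ × ℝ) (u : ℝ → ℂ) : Prop :=
  Continuous u ∧ ∀ t, (c t).1 ≠ 0 → u t ∈ periodLattice (c t)

end SphericalPendulum

end

/-!
The Chebyshev substitution `x = (x⁻ + x⁺) / 2 + (x⁺ - x⁻) / 2 * cos φ` turns `dx / √P(x)` into
`dφ / √(2 (x⁰ - x))`, so `T` is continuous wherever `x⁻ < x⁺ < x⁰`. In `Θ` the poles `x = ±1` of
`1 / (1 - x²)` remain. The integral of the polar part of the integrand is elementary and, as
`P(±1) = -j²`, its value depends on the sign of `j` only. With `z = (h - 1) + i j` this gives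
`Θ = S - arg z / 2π + sign j`, where `S` is continuous in a punctured neighbourhood of `(0, 1)`.
Hence `Θ` changes along a closed curve by minus the winding number of `z`, and `τ = -Θ + i T`
changes by the opposite integer.
-/

noncomputable section

namespace SphericalPendulum

open Real Set Filter MeasureTheory

/-! ### Integrals over a half-period -/

lemma continuousOn_parametric_integral {X E : Type*} [TopologicalSpace X]
    [NormedAddCommGroup E] [NormedSpace ℝ E] {s : Set X} {f : X → ℝ → E}
    (hf : ContinuousOn (fun q : X × ℝ => f q.1 q.2) (s ×ˢ univ)) (a b : ℝ) :
    ContinuousOn (fun x => ∫ t in a..b, f x t) s := by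
  rw [continuousOn_iff_continuous_domRestrict]
  refine intervalIntegral.continuous_parametric_intervalIntegral_of_continuous'
    (f := fun (x : s) t => f x t) ?_ a b
  exact hf.comp_continuous (f := fun q : s × ℝ => ((q.1 : X), q.2)) (by fun_prop)
    fun q => ⟨q.1.2, mem_univ _⟩

lemma inv_sqrt_sub_mul_sub {a b : ℝ} (hab : a < b) (y : ℝ) :
    √(1 - y ^ 2)⁻¹ = (b - a) / 2 *
      (√(((a + b) / 2 + (b - a) / 2 * y - a) * (b - ((a + b) / 2 + (b - a) / 2 * y))))⁻¹ := by
  have hr : 0 < (b - a) / 2 := by linarith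
  rw [show ((a + b) / 2 + (b - a) / 2 * y - a) * (b - ((a + b) / 2 + (b - a) / 2 * y)) =
      ((b - a) / 2) ^ 2 * (1 - y ^ 2) by ring, sqrt_mul (sq_nonneg _), sqrt_sq hr.le, mul_inv,
    mul_inv_cancel_left₀ hr.ne', sqrt_inv]

lemma intervalIntegrable_div_sqrt_sub_mul_sub {a b : ℝ} (hab : a < b) {f : ℝ → ℝ}
    (hf : ContinuousOn f (Icc a b)) :
    IntervalIntegrable (fun x => f x / √((x - a) * (b - x))) volume a b := by
  have hr : (b - a) / 2 ≠ 0 := by linarith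
  have hw := Polynomial.Chebyshev.intervalIntegrable_sqrt_one_sub_sq_inv.const_mul
    ((b - a) / 2)⁻¹
  have hw' : IntervalIntegrable (fun x => (√((x - a) * (b - x)))⁻¹) volume a b := by
    have := (hw.comp_mul_left (c := ((b - a) / 2)⁻¹)).comp_sub_right ((a + b) / 2)
    simp only [inv_sqrt_sub_mul_sub hab, inv_mul_cancel_left₀ hr, mul_inv_cancel_left₀ hr,
      add_sub_cancel, div_inv_eq_mul] at this
    convert this using 1 <;> ring
  simpa only [div_eq_mul_inv] using hw'.continuousOn_mul (by rwa [uIcc_of_le hab.le])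

lemma integral_div_sqrt_sub_mul_sub_eq_integral_cos {a b : ℝ} (hab : a < b) (f : ℝ → ℝ) :
    ∫ x in a..b, f x / √((x - a) * (b - x)) =
      ∫ θ in 0..π, f ((a + b) / 2 + (b - a) / 2 * cos θ) := by
  have key := intervalIntegral.mul_integral_comp_add_mul (a := -1) (b := 1)
    (f := fun x => f x / √((x - a) * (b - x))) ((b - a) / 2) ((a + b) / 2)
  rw [show (a + b) / 2 + (b - a) / 2 * -1 = a by ring,
    show (a + b) / 2 + (b - a) / 2 * 1 = b by ring] at key
  rw [← key, ← intervalIntegral.integral_const_mul,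
    ← Polynomial.Chebyshev.integral_measureT_eq_integral_cos
      (f := fun y => f ((a + b) / 2 + (b - a) / 2 * y)), Polynomial.Chebyshev.integral_measureT]
  refine intervalIntegral.integral_congr fun y _ => ?_
  simp only [inv_sqrt_sub_mul_sub hab y]
  ring

lemma integral_zero_two_pi_eq_two_mul_of_cos (f : ℝ → ℝ)
    (hf : Continuous fun θ => f (cos θ)) :
    ∫ θ in 0..(2 * π), f (cos θ) = 2 * ∫ θ in 0..π, f (cos θ) := by
  have hrefl : ∫ θ in π..(2 * π), f (cos θ) = ∫ θ in 0..π, f (cos θ) := by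
    have := intervalIntegral.integral_comp_sub_left (fun θ => f (cos θ)) (2 * π) (a := 0) (b := π)
    simp only [cos_two_pi_sub, sub_zero] at this
    rw [this]; congr 1; ring
  rw [← intervalIntegral.integral_add_adjacent_intervals (hf.intervalIntegrable 0 π)
    (hf.intervalIntegrable π (2 * π)), hrefl, two_mul]

lemma integral_poissonKernel_halfCircle {β : ℝ} (hβ : |β| < 1) :
    ∫ θ in 0..π, (1 - β ^ 2) / (1 + β ^ 2 - 2 * β * cos θ) = π := by
  have hkernel (θ : ℝ) : poissonKernel 0 β (circleMap 0 1 θ) =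
      (1 - β ^ 2) / (1 + β ^ 2 - 2 * β * cos θ) := by
    have hdist : ‖circleMap 0 1 θ - (β : ℂ)‖ ^ 2 = 1 + β ^ 2 - 2 * β * cos θ := by
      rw [← Complex.normSq_eq_norm_sq, Complex.normSq_apply]
      simp only [circleMap_zero, Complex.ofReal_one, one_mul, Complex.sub_re, Complex.sub_im,
        Complex.exp_ofReal_mul_I_re, Complex.exp_ofReal_mul_I_im, Complex.ofReal_re,
        Complex.ofReal_im]
      nlinarith [sin_sq_add_cos_sq θ]
    simp [poissonKernel, hdist]
  have hden (θ : ℝ) : 1 + β ^ 2 - 2 * β * cos θ ≠ 0 := by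
    have hlt : |β * cos θ| < 1 := by
      rw [abs_mul]
      exact (mul_le_of_le_one_right (abs_nonneg β) (abs_cos_le_one θ)).trans_lt hβ
    nlinarith [sin_sq_add_cos_sq θ, sq_nonneg (β - cos θ), abs_lt.1 hlt, sq_abs β, abs_nonneg β]
  have havg := (InnerProductSpace.harmonicOnNhd_const (1 : ℝ)).circleAverage_poissonKernel_smul
    (c := (0 : ℂ)) (R := 1) (w := (β : ℂ)) (by simpa using hβ)
  simp only [circleAverage_def, smul_eq_mul, Pi.mul_apply, mul_one, hkernel] at havg
  rw [integral_zero_two_pi_eq_two_mul_of_cos (fun y => (1 - β ^ 2) / (1 + β ^ 2 - 2 * β * y))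
    (by fun_prop (disch := exact hden _))] at havg
  field_simp at havg
  linarith

lemma integral_one_div_sub_cos {A r : ℝ} (hr : |r| < A) :
    ∫ θ in 0..π, 1 / (A - r * cos θ) = π / √(A ^ 2 - r ^ 2) := by
  have hA : 0 < A := (abs_nonneg r).trans_lt hr
  have hS2 : 0 < A ^ 2 - r ^ 2 := sub_pos.2 (sq_lt_sq.2 (by rwa [abs_of_pos hA]))
  obtain ⟨S, hS, hSdef⟩ : ∃ S, 0 < S ∧ S = √(A ^ 2 - r ^ 2) := ⟨_, sqrt_pos.2 hS2, rfl⟩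
  have hSS : S ^ 2 = A ^ 2 - r ^ 2 := by rw [hSdef, sq_sqrt hS2.le]
  have hβ : |r / (A + S)| < 1 := by
    rw [abs_div, abs_of_pos (by linarith : 0 < A + S), div_lt_one (by linarith)]
    linarith
  have hsub : 1 - (r / (A + S)) ^ 2 = 2 / (A + S) * S := by field_simp; linear_combination -hSS
  have hadd : 1 + (r / (A + S)) ^ 2 = 2 / (A + S) * A := by field_simp; linear_combination hSS
  rw [← hSdef, eq_div_iff hS.ne', ← intervalIntegral.integral_mul_const]
  refine Eq.trans (intervalIntegral.integral_congr fun θ _ => ?_)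
    (integral_poissonKernel_halfCircle hβ)
  rw [hsub, hadd, show 2 / (A + S) * A - 2 * (r / (A + S)) * cos θ =
    2 / (A + S) * (A - r * cos θ) by ring, mul_div_mul_left _ _ (by positivity), one_div_mul_eq_div]

lemma integral_one_div_sub_of_lt {a b e : ℝ} (hab : a ≤ b) (he : b < e) :
    ∫ θ in 0..π, 1 / (e - ((a + b) / 2 + (b - a) / 2 * cos θ)) = π / √((e - a) * (e - b)) := by
  have hr : |(b - a) / 2| < e - (a + b) / 2 := by
    rw [abs_of_nonneg (by linarith)]; linarith
  rw [show (e - a) * (e - b) = (e - (a + b) / 2) ^ 2 - ((b - a) / 2) ^ 2 by ring,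
    ← integral_one_div_sub_cos hr]
  simp only [sub_sub]

lemma integral_one_div_sub_of_gt {a b e : ℝ} (hab : a ≤ b) (he : e < a) :
    ∫ θ in 0..π, 1 / (e - ((a + b) / 2 + (b - a) / 2 * cos θ)) =
      -(π / √((e - a) * (e - b))) := by
  have hr : |-((b - a) / 2)| < (a + b) / 2 - e := by
    rw [abs_neg, abs_of_nonneg (by linarith)]; linarith
  rw [show (e - a) * (e - b) = ((a + b) / 2 - e) ^ 2 - (-((b - a) / 2)) ^ 2 by ring,
    ← integral_one_div_sub_cos hr, ← intervalIntegral.integral_neg]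
  refine intervalIntegral.integral_congr fun θ _ => ?_
  rw [← div_neg]
  ring

/-! ### The roots of `P` -/

/-- The regular values: the values `(j, h)` for which the pendulum has a genuine motion, `P` being
positive somewhere in `(-1, 1)`, with the unstable equilibrium value `(0, 1)` removed. -/
def regularValues : Set (ℝ × ℝ) := {p | p ≠ (0, 1) ∧ ∃ x ∈ Ioo (-1) 1, 0 < P p x}

@[fun_prop]
lemma continuous_uncurry_P : Continuous fun q : (ℝ × ℝ) × ℝ => P q.1 q.2 := by
  unfold P; fun_prop

lemma P_one (p : ℝ × ℝ) : P p 1 = -p.1 ^ 2 := by simp [P]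

lemma P_neg_one (p : ℝ × ℝ) : P p (-1) = -p.1 ^ 2 := by simp [P]

lemma isOpen_regularValues : IsOpen regularValues := by
  have hunion : regularValues = {(0, 1)}ᶜ ∩ ⋃ x ∈ Ioo (-1 : ℝ) 1, {p | 0 < P p x} := by
    ext p; simp [regularValues]
  rw [hunion]
  exact isOpen_compl_singleton.inter <| isOpen_biUnion fun x _ =>
    isOpen_lt continuous_const (by fun_prop)

lemma mem_regularValues_of_sq_add_sq_lt_one {p : ℝ × ℝ} (hp : p ≠ (0, 1))
    (h : p.1 ^ 2 + (p.2 - 1) ^ 2 < 1) : p ∈ regularValues := by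
  refine ⟨hp, 0, by norm_num, ?_⟩
  simp only [P]
  nlinarith [sq_nonneg p.2]

lemma P_eq_mul_of_eq_zero {p : ℝ × ℝ} {a b : ℝ} (ha : P p a = 0) (hb : P p b = 0) (hab : a ≠ b)
    (x : ℝ) : P p x = 2 * (x - a) * (x - b) * (x - (p.2 - a - b)) := by
  have hpair : a ^ 2 + a * b + b ^ 2 - p.2 * (a + b) - 1 = 0 := by
    refine mul_left_cancel₀ (sub_ne_zero.2 hab) ?_
    simp only [P] at ha hb
    linear_combination (ha - hb) / 2
  simp only [P] at ha ⊢
  linear_combination ha + 2 * (x - a) * hpair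

lemma exists_roots_on_both_sides {p : ℝ × ℝ} {x : ℝ} (hx : x ∈ Ioo (-1) 1) (hPx : 0 < P p x) :
    (∃ a ∈ Ico (-1) x, P p a = 0) ∧ ∃ b ∈ Ioc x 1, P p b = 0 := by
  have hcont : Continuous (P p) := by fun_prop
  have hneg : -p.1 ^ 2 ≤ 0 := neg_nonpos.2 (sq_nonneg _)
  obtain ⟨a, ha, hPa⟩ := intermediate_value_Icc hx.1.le hcont.continuousOn
    ⟨(P_neg_one p).trans_le hneg, hPx.le⟩
  obtain ⟨b, hb, hPb⟩ := intermediate_value_Icc' hx.2.le hcont.continuousOn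
    ⟨(P_one p).trans_le hneg, hPx.le⟩
  exact ⟨⟨a, ⟨ha.1, ha.2.lt_of_ne (by rintro rfl; exact hPx.ne' hPa)⟩, hPa⟩,
    b, ⟨hb.1.lt_of_ne (by rintro rfl; exact hPx.ne' hPb), hb.2⟩, hPb⟩

lemma exists_ordered_roots {p : ℝ × ℝ} (hp : p ∈ regularValues) :
    ∃ a b c : ℝ, -1 ≤ a ∧ a < b ∧ b ≤ 1 ∧ 1 ≤ c ∧ b < c ∧
      ∀ x, P p x = 2 * (x - a) * (x - b) * (x - c) := by
  obtain ⟨hne, x, hx, hPx⟩ := hp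
  obtain ⟨⟨a, ⟨ha₁, hax⟩, hPa⟩, s, ⟨hxs, hs₂⟩, hPs⟩ := exists_roots_on_both_sides hx hPx
  have hfac := P_eq_mul_of_eq_zero hPa hPs (hax.trans hxs).ne
  obtain ⟨t, ht⟩ : ∃ t, t = p.2 - a - s := ⟨_, rfl⟩
  rw [← ht] at hfac
  have hxt : x < t := by
    by_contra! htx
    rw [hfac] at hPx
    exact hPx.not_ge (mul_nonpos_of_nonpos_of_nonneg
      (mul_nonpos_of_nonneg_of_nonpos (by linarith) (by linarith)) (by linarith))
  have hst : (1 - s) * (1 - t) ≤ 0 := by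
    have h1 := hfac 1
    rw [P_one] at h1
    nlinarith
  have hst_ne : s ≠ t := by
    rintro rfl
    obtain rfl : s = 1 := by nlinarith [sq_nonneg (1 - s)]
    have hj : p.1 = 0 := by simpa [P_one] using hPs
    have ha : a = -1 := by
      have h1 := hfac (-1)
      rw [P_neg_one, hj] at h1
      linarith
    exact hne (Prod.ext hj (by linarith))
  rcases hst_ne.lt_or_gt with hlt | hlt
  · have ht₁ : 1 ≤ t := by by_contra! ht₁; nlinarith
    exact ⟨a, s, t, ha₁, hax.trans hxs, hs₂, ht₁, hlt, hfac⟩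
  · have hs₁ : 1 ≤ s := by by_contra! hs₁; nlinarith
    exact ⟨a, t, s, ha₁, hax.trans hxt, hlt.le.trans hs₂, hs₁, hlt, fun y => by rw [hfac]; ring⟩

lemma roots_eq {p : ℝ × ℝ} {a b c : ℝ} (hab : a < b) (hbc : b < c)
    (hP : ∀ x, P p x = 2 * (x - a) * (x - b) * (x - c)) :
    xMinus p = a ∧ xPlus p = b ∧ xZero p = c := by
  have hroot (x : ℝ) : P p x = 0 ↔ x = a ∨ x = b ∨ x = c := by
    simp [hP, sub_eq_zero, or_assoc]
  have ha : xMinus p = a := IsLeast.csInf_eq ⟨by simp [hroot], by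
    rintro x hx
    rcases (hroot x).1 hx with rfl | rfl | rfl <;> linarith⟩
  have hb : xPlus p = b := IsLeast.csInf_eq ⟨by simp [hroot, ha, hab], by
    rintro x ⟨hax, hx⟩
    rcases (hroot x).1 hx with rfl | rfl | rfl <;> linarith⟩
  have hc : xZero p = c := IsLeast.csInf_eq ⟨by simp [hroot, hb, hbc], by
    rintro x ⟨hbx, hx⟩
    rcases (hroot x).1 hx with rfl | rfl | rfl <;> linarith⟩
  exact ⟨ha, hb, hc⟩

section Roots

variable {p : ℝ × ℝ}

lemma roots_spec (hp : p ∈ regularValues) :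
    (-1 ≤ xMinus p ∧ xMinus p < xPlus p ∧ xPlus p ≤ 1 ∧ 1 ≤ xZero p ∧ xPlus p < xZero p) ∧
      ∀ x, P p x = 2 * (x - xMinus p) * (x - xPlus p) * (x - xZero p) := by
  obtain ⟨a, b, c, ha, hab, hb, hc, hbc, hP⟩ := exists_ordered_roots hp
  obtain ⟨rfl, rfl, rfl⟩ := roots_eq hab hbc hP
  exact ⟨⟨ha, hab, hb, hc, hbc⟩, hP⟩

lemma neg_one_le_xMinus (hp : p ∈ regularValues) : -1 ≤ xMinus p := (roots_spec hp).1.1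

lemma xMinus_lt_xPlus (hp : p ∈ regularValues) : xMinus p < xPlus p := (roots_spec hp).1.2.1

lemma xPlus_le_one (hp : p ∈ regularValues) : xPlus p ≤ 1 := (roots_spec hp).1.2.2.1

lemma one_le_xZero (hp : p ∈ regularValues) : 1 ≤ xZero p := (roots_spec hp).1.2.2.2.1

lemma xPlus_lt_xZero (hp : p ∈ regularValues) : xPlus p < xZero p := (roots_spec hp).1.2.2.2.2

lemma P_eq_mul (hp : p ∈ regularValues) (x : ℝ) :
    P p x = 2 * (x - xMinus p) * (x - xPlus p) * (x - xZero p) := (roots_spec hp).2 x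

lemma xMinus_add_xPlus_add_xZero (hp : p ∈ regularValues) :
    xMinus p + xPlus p + xZero p = p.2 := by
  have h0 := P_eq_mul hp 0
  have h1 := P_eq_mul hp 1
  have h2 := P_eq_mul hp (-1)
  simp only [P] at h0 h1 h2
  linarith

lemma neg_one_lt_xMinus (hp : p ∈ regularValues) (hj : p.1 ≠ 0) : -1 < xMinus p := by
  refine (neg_one_le_xMinus hp).lt_of_ne fun h => hj ?_
  simpa [← h, P_neg_one] using P_eq_mul hp (-1)

lemma xPlus_lt_one (hp : p ∈ regularValues) (hj : p.1 ≠ 0) : xPlus p < 1 := by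
  refine (xPlus_le_one hp).lt_of_ne fun h => hj ?_
  simpa [h, P_one] using P_eq_mul hp 1

lemma snd_ne_one (hp : p ∈ regularValues) (hj : p.1 = 0) : p.2 ≠ 1 := fun h =>
  hp.1 (Prod.ext hj h)

lemma snd_lt_one (hp : p ∈ regularValues) (hj : p.1 = 0) (h : xPlus p < 1) : p.2 < 1 := by
  by_contra! hh
  refine h.ne (roots_eq (a := -1) (by norm_num) (hh.lt_of_ne' (snd_ne_one hp hj)) ?_).2.1
  intro x
  simp only [P, hj]
  ring

lemma one_lt_snd (hp : p ∈ regularValues) (hj : p.1 = 0) (h : 1 < xZero p) : 1 < p.2 := by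
  obtain ⟨x, ⟨hx₁, hx₂⟩, hPx⟩ := hp.2
  by_contra! hh
  have hx : x < p.2 := by
    have hpos : 0 < (p.2 - x) * (1 - x ^ 2) := by
      simp only [P, hj] at hPx
      linarith
    exact sub_pos.1 (pos_of_mul_pos_left hpos (by nlinarith))
  refine h.ne' (roots_eq (a := -1) (hx₁.trans hx) (hh.lt_of_ne (snd_ne_one hp hj)) ?_).2.2
  intro x
  simp only [P, hj]
  ring

lemma P_eq_outer_mul_inner (hp : p ∈ regularValues) (x : ℝ) :
    P p x = 2 * (xZero p - x) * ((x - xMinus p) * (xPlus p - x)) := by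
  rw [P_eq_mul hp]; ring

lemma mem_Ioo_of_P_pos (hp : p ∈ regularValues) {x : ℝ} (hx : x ≤ xZero p) (hP : 0 < P p x) :
    x ∈ Ioo (xMinus p) (xPlus p) := by
  rw [P_eq_outer_mul_inner hp] at hP
  have hab := xMinus_lt_xPlus hp
  rcases mul_pos_iff.1 (pos_of_mul_pos_right hP (by linarith)) with h | h
  · exact ⟨by linarith, by linarith⟩
  · linarith

lemma P_pos (hp : p ∈ regularValues) {x : ℝ} (hx : x ∈ Ioo (xMinus p) (xPlus p)) :
    0 < P p x := by
  rw [P_eq_outer_mul_inner hp]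
  have hbc := xPlus_lt_xZero hp
  exact mul_pos (by linarith [hx.2]) (mul_pos (sub_pos.2 hx.1) (sub_pos.2 hx.2))

lemma P_neg (hp : p ∈ regularValues) {x : ℝ} (hx : x < xMinus p ∨ xPlus p < x)
    (hxc : x < xZero p) : P p x < 0 := by
  rw [P_eq_outer_mul_inner hp]
  have hab := xMinus_lt_xPlus hp
  refine mul_neg_of_pos_of_neg (by linarith) ?_
  rcases hx with hx | hx
  · exact mul_neg_of_neg_of_pos (by linarith) (by linarith)
  · exact mul_neg_of_pos_of_neg (by linarith) (by linarith)

lemma lt_xMinus_or_xPlus_lt_of_P_neg (hp : p ∈ regularValues) {x : ℝ} (hP : P p x < 0) :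
    x < xMinus p ∨ xPlus p < x := by
  by_contra! h
  rw [P_eq_outer_mul_inner hp] at hP
  have hbc := xPlus_lt_xZero hp
  exact hP.not_ge (mul_nonneg (by linarith) (mul_nonneg (by linarith) (by linarith)))

lemma eventually_mem_Ioo_roots (hp : p ∈ regularValues) {x : ℝ}
    (hx : x ∈ Ioo (xMinus p) (xPlus p)) :
    ∀ᶠ q in 𝓝[regularValues] p, x ∈ Ioo (xMinus q) (xPlus q) := by
  have hP : ContinuousAt (fun q => P q x) p := by fun_prop
  filter_upwards [self_mem_nhdsWithin,
    nhdsWithin_le_nhds (hP.eventually (lt_mem_nhds (P_pos hp hx)))] with q hq hPq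
  exact mem_Ioo_of_P_pos hq ((hx.2.le.trans (xPlus_le_one hp)).trans (one_le_xZero hq)) hPq

lemma eventually_lt_xMinus_or_xPlus_lt (hp : p ∈ regularValues) {x : ℝ}
    (hx : x < xMinus p ∨ xPlus p < x) (hxc : x < xZero p) :
    ∀ᶠ q in 𝓝[regularValues] p, x < xMinus q ∨ xPlus q < x := by
  have hP : ContinuousAt (fun q => P q x) p := by fun_prop
  filter_upwards [self_mem_nhdsWithin,
    nhdsWithin_le_nhds (hP.eventually (gt_mem_nhds (P_neg hp hx hxc)))] with q hq hPq
  exact lt_xMinus_or_xPlus_lt_of_P_neg hq hPq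

end Roots

@[fun_prop]
lemma continuousOn_xMinus : ContinuousOn xMinus regularValues := by
  intro p hp
  have hab := xMinus_lt_xPlus hp
  have hbc := xPlus_lt_xZero hp
  obtain ⟨m, hm⟩ := exists_between hab
  refine tendsto_order.2 ⟨fun y hy => ?_, fun y hy => ?_⟩
  · filter_upwards [eventually_mem_Ioo_roots hp hm,
      eventually_lt_xMinus_or_xPlus_lt hp (Or.inl hy) (by linarith)] with q hmq hyq
    exact hyq.resolve_right (by linarith [hmq.2, hm.1])
  · obtain ⟨x, hax, hx⟩ := exists_between (lt_min hy hab)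
    obtain ⟨hxy, hxb⟩ := lt_min_iff.1 hx
    filter_upwards [eventually_mem_Ioo_roots hp ⟨hax, hxb⟩] with q hq using hq.1.trans hxy

@[fun_prop]
lemma continuousOn_xPlus : ContinuousOn xPlus regularValues := by
  intro p hp
  have hab := xMinus_lt_xPlus hp
  have hbc := xPlus_lt_xZero hp
  obtain ⟨m, hm⟩ := exists_between hab
  refine tendsto_order.2 ⟨fun y hy => ?_, fun y hy => ?_⟩
  · obtain ⟨x, hx, hxb⟩ := exists_between (max_lt hy hab)
    obtain ⟨hyx, hax⟩ := max_lt_iff.1 hx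
    filter_upwards [eventually_mem_Ioo_roots hp ⟨hax, hxb⟩] with q hq using hyx.trans hq.2
  · obtain ⟨x, hbx, hx⟩ := exists_between (lt_min hy hbc)
    obtain ⟨hxy, hxc⟩ := lt_min_iff.1 hx
    filter_upwards [eventually_mem_Ioo_roots hp hm,
      eventually_lt_xMinus_or_xPlus_lt hp (Or.inr hbx) hxc] with q hmq hxq
    exact (hxq.resolve_left (by linarith [hmq.1, hm.2])).trans hxy

@[fun_prop]
lemma continuousOn_xZero : ContinuousOn xZero regularValues := by
  refine ContinuousOn.congr (f := fun p => p.2 - xMinus p - xPlus p) (by fun_prop) fun p hp => ?_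
  linarith [xMinus_add_xPlus_add_xZero hp]

/-! ### The period integrals in the Chebyshev parametrization -/

/-- The Chebyshev parametrization of the interval `[x⁻, x⁺]` by an angle. -/
def height (p : ℝ × ℝ) (θ : ℝ) : ℝ :=
  (xMinus p + xPlus p) / 2 + (xPlus p - xMinus p) / 2 * cos θ

/-- The square root of the factor `2 (x⁰ - x)` of `P`, which has no zero on `[x⁻, x⁺]`. -/
def outerSqrt (p : ℝ × ℝ) (x : ℝ) : ℝ := √(2 * (xZero p - x))

/-- The contribution of the pole `x = e` of `1 / (1 - x²)` to the rotation number, up to a constant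
factor: the integral of `dx / ((e - x) √P(x))` over `[x⁻, x⁺]`. -/
def poleIntegral (p : ℝ × ℝ) (e : ℝ) : ℝ :=
  ∫ θ in 0..π, 1 / ((e - height p θ) * outerSqrt p (height p θ))

/-- What is left of `-poleIntegral p e` when the residue at `x = e` is split off. -/
def regularPart (p : ℝ × ℝ) (e : ℝ) : ℝ :=
  ∫ θ in 0..π, 2 / (outerSqrt p (height p θ) * outerSqrt p e *
    (outerSqrt p (height p θ) + outerSqrt p e))

section Integrals

variable {p : ℝ × ℝ}

@[fun_prop]
lemma continuous_height (p : ℝ × ℝ) : Continuous (height p) := by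
  unfold height; fun_prop

@[fun_prop]
lemma continuous_outerSqrt (p : ℝ × ℝ) : Continuous (outerSqrt p) := by
  unfold outerSqrt; fun_prop

lemma height_mem_Icc (hp : p ∈ regularValues) (θ : ℝ) :
    height p θ ∈ Icc (xMinus p) (xPlus p) := by
  have hab := xMinus_lt_xPlus hp
  unfold height
  constructor <;> nlinarith [cos_le_one θ, neg_one_le_cos θ]

lemma outerSqrt_pos {x : ℝ} (hx : x < xZero p) : 0 < outerSqrt p x := sqrt_pos.2 (by linarith)

lemma outerSqrt_height_pos (hp : p ∈ regularValues) (θ : ℝ) : 0 < outerSqrt p (height p θ) :=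
  outerSqrt_pos ((height_mem_Icc hp θ).2.trans_lt (xPlus_lt_xZero hp))

lemma sqrt_P (hp : p ∈ regularValues) {x : ℝ} (hx : x ≤ xZero p) :
    √(P p x) = outerSqrt p x * √((x - xMinus p) * (xPlus p - x)) := by
  rw [P_eq_outer_mul_inner hp, sqrt_mul (by linarith), outerSqrt]

lemma sqrt_neg_P (hp : p ∈ regularValues) {x : ℝ} (hx : x ≤ xZero p) :
    √(-P p x) = outerSqrt p x * √((x - xMinus p) * (x - xPlus p)) := by
  rw [P_eq_outer_mul_inner hp, ← mul_neg, sqrt_mul (by linarith), outerSqrt]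
  congr 2; ring

lemma div_sqrt_P_eqOn (hp : p ∈ regularValues) (f : ℝ → ℝ) :
    EqOn (fun x => f x / √(P p x))
      (fun x => f x / outerSqrt p x / √((x - xMinus p) * (xPlus p - x)))
      (uIcc (xMinus p) (xPlus p)) := by
  intro x hx
  rw [uIcc_of_le (xMinus_lt_xPlus hp).le] at hx
  simp only [sqrt_P hp (hx.2.trans (xPlus_lt_xZero hp).le), div_div]

lemma integral_div_sqrt_P (hp : p ∈ regularValues) (f : ℝ → ℝ) :
    ∫ x in xMinus p..xPlus p, f x / √(P p x) =
      ∫ θ in 0..π, f (height p θ) / outerSqrt p (height p θ) := by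
  rw [intervalIntegral.integral_congr (div_sqrt_P_eqOn hp f),
    integral_div_sqrt_sub_mul_sub_eq_integral_cos (xMinus_lt_xPlus hp)
      fun x => f x / outerSqrt p x]
  rfl

lemma intervalIntegrable_div_sqrt_P (hp : p ∈ regularValues) {f : ℝ → ℝ}
    (hf : ContinuousOn f (Icc (xMinus p) (xPlus p))) :
    IntervalIntegrable (fun x => f x / √(P p x)) volume (xMinus p) (xPlus p) := by
  have hfo : ContinuousOn (fun x => f x / outerSqrt p x) (Icc (xMinus p) (xPlus p)) :=
    hf.div (by fun_prop) fun x hx => (outerSqrt_pos (hx.2.trans_lt (xPlus_lt_xZero hp))).ne'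
  exact (intervalIntegrable_div_sqrt_sub_mul_sub (xMinus_lt_xPlus hp) hfo).congr
    fun x hx => (div_sqrt_P_eqOn hp f (uIoc_subset_uIcc hx)).symm

lemma returnTime_eq (hp : p ∈ regularValues) :
    returnTime p = 2 * ∫ θ in 0..π, 1 / outerSqrt p (height p θ) := by
  rw [returnTime, integral_div_sqrt_P hp fun _ => 1]

lemma returnTime_pos (hp : p ∈ regularValues) : 0 < returnTime p := by
  have hcont : Continuous fun θ => 1 / outerSqrt p (height p θ) :=
    continuous_const.div (by fun_prop) fun θ => (outerSqrt_height_pos hp θ).ne'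
  rw [returnTime_eq hp]
  exact mul_pos two_pos (intervalIntegral.intervalIntegral_pos_of_pos_on
    (hcont.intervalIntegrable 0 π) (fun θ _ => one_div_pos.2 (outerSqrt_height_pos hp θ)) pi_pos)

lemma one_sub_sq_pos_of_mem_Icc (hp : p ∈ regularValues) (hj : p.1 ≠ 0) {x : ℝ}
    (hx : x ∈ Icc (xMinus p) (xPlus p)) : 0 < 1 - x ^ 2 := by
  nlinarith [(neg_one_lt_xMinus hp hj).trans_le hx.1, hx.2.trans_lt (xPlus_lt_one hp hj)]

lemma intervalIntegrable_one_div_one_sub_sq_mul_sqrt_P (hp : p ∈ regularValues) (hj : p.1 ≠ 0) :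
    IntervalIntegrable (fun x => 1 / ((1 - x ^ 2) * √(P p x))) volume (xMinus p) (xPlus p) := by
  simp only [← div_div]
  exact intervalIntegrable_div_sqrt_P hp <| continuousOn_const.div (by fun_prop)
    fun x hx => (one_sub_sq_pos_of_mem_Icc hp hj hx).ne'

lemma intervalIntegrable_pole (hp : p ∈ regularValues) {e : ℝ}
    (he : e ∉ Icc (xMinus p) (xPlus p)) :
    IntervalIntegrable (fun θ => 1 / ((e - height p θ) * outerSqrt p (height p θ))) volume 0 π := by
  refine (continuous_const.div (by fun_prop) fun θ => ?_).intervalIntegrable 0 π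
  refine mul_ne_zero (sub_ne_zero.2 ?_) (outerSqrt_height_pos hp θ).ne'
  rintro rfl
  exact he (height_mem_Icc hp θ)

lemma rotationNumber_eq_poleIntegral (hp : p ∈ regularValues) (hj : p.1 ≠ 0) :
    rotationNumber p = p.1 / (2 * π) * (poleIntegral p 1 - poleIntegral p (-1)) := by
  have hint : ∫ x in xMinus p..xPlus p, 1 / ((1 - x ^ 2) * √(P p x)) =
      (poleIntegral p 1 - poleIntegral p (-1)) / 2 := by
    simp only [← div_div]
    rw [integral_div_sqrt_P hp fun x => 1 / (1 - x ^ 2), poleIntegral, poleIntegral,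
      ← intervalIntegral.integral_sub
        (intervalIntegrable_pole hp fun h => h.2.not_gt (xPlus_lt_one hp hj))
        (intervalIntegrable_pole hp fun h => h.1.not_gt (neg_one_lt_xMinus hp hj)),
      ← intervalIntegral.integral_div]
    refine intervalIntegral.integral_congr fun θ _ => ?_
    have hsq := one_sub_sq_pos_of_mem_Icc hp hj (height_mem_Icc hp θ)
    have hu := outerSqrt_height_pos hp θ
    have h1 : 1 - height p θ ≠ 0 := fun h => by nlinarith
    have h2 : -1 - height p θ ≠ 0 := fun h => by nlinarith
    field_simp
    ring
  rw [rotationNumber, hint]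
  ring

lemma one_div_pole_mul_outerSqrt (hp : p ∈ regularValues) {e : ℝ} (he : e < xZero p) (θ : ℝ)
    (hne : e ≠ height p θ) :
    1 / ((e - height p θ) * outerSqrt p (height p θ)) =
      1 / (e - height p θ) / outerSqrt p e -
        2 / (outerSqrt p (height p θ) * outerSqrt p e *
          (outerSqrt p (height p θ) + outerSqrt p e)) := by
  have hu := outerSqrt_height_pos hp θ
  have hv := outerSqrt_pos he
  have hu2 : outerSqrt p (height p θ) ^ 2 = 2 * (xZero p - height p θ) :=
    sq_sqrt (sqrt_pos.1 hu).le
  have hv2 : outerSqrt p e ^ 2 = 2 * (xZero p - e) := sq_sqrt (sqrt_pos.1 hv).le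
  have hsub := sub_ne_zero.2 hne
  field_simp
  linear_combination hv2 - hu2

lemma poleIntegral_eq (hp : p ∈ regularValues) {e : ℝ} (he : e ∉ Icc (xMinus p) (xPlus p))
    (he' : e < xZero p) :
    poleIntegral p e = (∫ θ in 0..π, 1 / (e - height p θ)) / outerSqrt p e - regularPart p e := by
  have hne (θ : ℝ) : e ≠ height p θ := by
    rintro rfl
    exact he (height_mem_Icc hp θ)
  have hpole : Continuous fun θ => 1 / (e - height p θ) / outerSqrt p e :=
    (continuous_const.div (by fun_prop) fun θ => sub_ne_zero.2 (hne θ)).div_const _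
  have hreg : Continuous fun θ => 2 / (outerSqrt p (height p θ) * outerSqrt p e *
      (outerSqrt p (height p θ) + outerSqrt p e)) := by
    refine continuous_const.div (by fun_prop) fun θ => ?_
    have hu := outerSqrt_height_pos hp θ
    have hv := outerSqrt_pos he'
    positivity
  rw [poleIntegral, regularPart, ← intervalIntegral.integral_div,
    ← intervalIntegral.integral_sub (hpole.intervalIntegrable 0 π) (hreg.intervalIntegrable 0 π)]
  exact intervalIntegral.integral_congr fun θ _ => one_div_pole_mul_outerSqrt hp he' θ (hne θ)

lemma poleIntegral_of_lt_xMinus (hp : p ∈ regularValues) {e : ℝ} (he : e < xMinus p) :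
    poleIntegral p e = -(π / √(-P p e)) - regularPart p e := by
  have he' : e < xZero p := he.trans ((xMinus_lt_xPlus hp).trans (xPlus_lt_xZero hp))
  rw [poleIntegral_eq hp (fun h => h.1.not_gt he) he', sqrt_neg_P hp he'.le]
  simp only [height]
  rw [integral_one_div_sub_of_gt (xMinus_lt_xPlus hp).le he, neg_div, div_div, mul_comm (√_)]

lemma poleIntegral_of_xPlus_lt (hp : p ∈ regularValues) {e : ℝ} (he : xPlus p < e)
    (he' : e < xZero p) :
    poleIntegral p e = π / √(-P p e) - regularPart p e := by
  rw [poleIntegral_eq hp (fun h => h.2.not_gt he) he', sqrt_neg_P hp he'.le]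
  simp only [height]
  rw [integral_one_div_sub_of_lt (xMinus_lt_xPlus hp).le he, div_div, mul_comm (√_)]

end Integrals

lemma continuousOn_outerSqrt (e : ℝ) : ContinuousOn (fun p => outerSqrt p e) regularValues := by
  unfold outerSqrt; fun_prop

lemma continuousOn_height :
    ContinuousOn (fun q : (ℝ × ℝ) × ℝ => height q.1 q.2) (regularValues ×ˢ univ) := by
  have ha : ContinuousOn (fun q : (ℝ × ℝ) × ℝ => xMinus q.1) (regularValues ×ˢ univ) :=
    continuousOn_xMinus.comp continuousOn_fst fun q hq => hq.1
  have hb : ContinuousOn (fun q : (ℝ × ℝ) × ℝ => xPlus q.1) (regularValues ×ˢ univ) :=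
    continuousOn_xPlus.comp continuousOn_fst fun q hq => hq.1
  unfold height
  fun_prop

lemma continuousOn_outerSqrt_height :
    ContinuousOn (fun q : (ℝ × ℝ) × ℝ => outerSqrt q.1 (height q.1 q.2))
      (regularValues ×ˢ univ) := by
  have hc : ContinuousOn (fun q : (ℝ × ℝ) × ℝ => xZero q.1) (regularValues ×ˢ univ) :=
    continuousOn_xZero.comp continuousOn_fst fun q hq => hq.1
  have hx := continuousOn_height
  unfold outerSqrt
  fun_prop

lemma continuousOn_returnTime : ContinuousOn returnTime regularValues := by
  refine ContinuousOn.congr ?_ fun p hp => returnTime_eq hp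
  refine continuousOn_const.mul (continuousOn_parametric_integral ?_ 0 π)
  exact continuousOn_const.div continuousOn_outerSqrt_height
    fun q hq => (outerSqrt_height_pos hq.1 q.2).ne'

lemma continuousOn_poleIntegral (e : ℝ) :
    ContinuousOn (fun p => poleIntegral p e) (regularValues ∩ {p | xPlus p < e}) := by
  have hsub : (regularValues ∩ {p | xPlus p < e}) ×ˢ (univ : Set ℝ) ⊆ regularValues ×ˢ univ :=
    prod_mono_left inter_subset_left
  have hx := continuousOn_height.mono hsub
  have hu := continuousOn_outerSqrt_height.mono hsub
  refine continuousOn_parametric_integral (continuousOn_const.div (by fun_prop) fun q hq => ?_) 0 π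
  have hlt : height q.1 q.2 < e := (height_mem_Icc hq.1.1 q.2).2.trans_lt hq.1.2
  exact mul_ne_zero (sub_pos.2 hlt).ne' (outerSqrt_height_pos hq.1.1 q.2).ne'

lemma continuousOn_regularPart (e : ℝ) :
    ContinuousOn (fun p => regularPart p e) (regularValues ∩ {p | e < xZero p}) := by
  have hu := continuousOn_outerSqrt_height.mono
    (prod_mono_left (inter_subset_left (s := regularValues) (t := {p | e < xZero p})))
  have hv : ContinuousOn (fun q : (ℝ × ℝ) × ℝ => outerSqrt q.1 e)
      ((regularValues ∩ {p | e < xZero p}) ×ˢ univ) :=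
    (continuousOn_outerSqrt e).comp continuousOn_fst fun q hq => hq.1.1
  refine continuousOn_parametric_integral (continuousOn_const.div (by fun_prop) fun q hq => ?_) 0 π
  have hu0 := outerSqrt_height_pos hq.1.1 q.2
  have hv0 := outerSqrt_pos hq.1.2
  positivity

lemma continuousOn_regularPart_neg_one :
    ContinuousOn (fun p => regularPart p (-1)) regularValues :=
  (continuousOn_regularPart (-1)).mono fun _ hp =>
    ⟨hp, neg_one_lt_zero.trans_le (zero_le_one.trans (one_le_xZero hp))⟩

/-! ### The multivalued part of the rotation number -/

/-- The displacement `(h - 1) + i j` from the critical value `(0, 1)`. -/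
def displacement (p : ℝ × ℝ) : ℂ := ⟨p.2 - 1, p.1⟩

/-- The single-valued part of the rotation number: what remains of `Θ` when its multivalued part
`-arg ((h - 1) + i j) / 2π` and the integer jump `sign j` are removed. On `j = 0`, where the
integral for `Θ` diverges, it gets its limit, which is `0`. -/
def singleValuedPart (p : ℝ × ℝ) : ℝ :=
  if p.1 = 0 then 0
  else rotationNumber p + (displacement p).arg / (2 * π) - (SignType.sign p.1 : ℝ)

@[fun_prop]
lemma continuous_displacement : Continuous displacement :=
  Complex.equivRealProdCLM.symm.continuous.comp
    ((continuous_snd.sub continuous_const).prodMk continuous_fst)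

lemma arg_neg_of_im_ne_zero {z : ℂ} (hz : z.im ≠ 0) :
    (-z).arg = z.arg - π * (SignType.sign z.im : ℝ) := by
  rcases hz.lt_or_gt with h | h
  · rw [Complex.arg_neg_eq_arg_add_pi_of_im_neg h, sign_neg h]; simp
  · rw [Complex.arg_neg_eq_arg_sub_pi_of_im_pos h, sign_pos h]; simp

lemma div_mul_pi_div_abs {j : ℝ} (hj : j ≠ 0) :
    j / (2 * π) * (π / |j|) = (SignType.sign j : ℝ) / 2 := by
  have hsign : (SignType.sign j : ℝ) = j / |j| := by
    rw [eq_div_iff (abs_ne_zero.2 hj), mul_comm, abs_mul_sign]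
  rw [hsign]
  field_simp

section SingleValuedPart

variable {p : ℝ × ℝ}

lemma rotationNumber_eq (hj : p.1 ≠ 0) :
    rotationNumber p =
      singleValuedPart p - (displacement p).arg / (2 * π) + (SignType.sign p.1 : ℝ) := by
  rw [singleValuedPart, if_neg hj]
  ring

lemma rotationNumber_eq_arg_neg (hj : p.1 ≠ 0) :
    rotationNumber p =
      singleValuedPart p - (-displacement p).arg / (2 * π) + (SignType.sign p.1 : ℝ) / 2 := by
  rw [rotationNumber_eq hj, arg_neg_of_im_ne_zero (z := displacement p) hj]
  simp only [displacement]
  field_simp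
  ring

lemma sqrt_neg_P_one (p : ℝ × ℝ) : √(-P p 1) = |p.1| := by
  rw [P_one, neg_neg, sqrt_sq_eq_abs]

lemma sqrt_neg_P_neg_one (p : ℝ × ℝ) : √(-P p (-1)) = |p.1| := by
  rw [P_neg_one, neg_neg, sqrt_sq_eq_abs]

lemma displacement_mem_slitPlane (hp : p ∈ regularValues) (h : 1 < xZero p) :
    displacement p ∈ Complex.slitPlane := by
  by_cases hj : p.1 = 0
  · exact Or.inl (sub_pos.2 (one_lt_snd hp hj h))
  · exact Or.inr hj

lemma neg_displacement_mem_slitPlane (hp : p ∈ regularValues) (h : xPlus p < 1) :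
    -displacement p ∈ Complex.slitPlane := by
  by_cases hj : p.1 = 0
  · exact Or.inl (neg_pos.2 (sub_neg.2 (snd_lt_one hp hj h)))
  · exact Or.inr (neg_ne_zero.2 hj)

lemma singleValuedPart_of_one_lt_xZero (hp : p ∈ regularValues) (h : 1 < xZero p) :
    singleValuedPart p =
      p.1 / (2 * π) * (regularPart p (-1) - regularPart p 1) + (displacement p).arg / (2 * π) := by
  by_cases hj : p.1 = 0
  · have harg : (displacement p).arg = 0 :=
      Complex.arg_eq_zero_iff.2 ⟨sub_nonneg.2 (one_lt_snd hp hj h).le, hj⟩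
    simp [singleValuedPart, hj, harg]
  · have hpole : rotationNumber p = p.1 / (2 * π) * (regularPart p (-1) - regularPart p 1) +
        (SignType.sign p.1 : ℝ) := by
      rw [rotationNumber_eq_poleIntegral hp hj, poleIntegral_of_xPlus_lt hp (xPlus_lt_one hp hj) h,
        poleIntegral_of_lt_xMinus hp (neg_one_lt_xMinus hp hj), sqrt_neg_P_one, sqrt_neg_P_neg_one]
      linear_combination 2 * div_mul_pi_div_abs hj
    linear_combination hpole - rotationNumber_eq hj

lemma singleValuedPart_of_xPlus_lt_one (hp : p ∈ regularValues) (h : xPlus p < 1) :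
    singleValuedPart p =
      p.1 / (2 * π) * (poleIntegral p 1 + regularPart p (-1)) +
        (-displacement p).arg / (2 * π) := by
  by_cases hj : p.1 = 0
  · have harg : (-displacement p).arg = 0 :=
      Complex.arg_eq_zero_iff.2
        ⟨neg_nonneg.2 (sub_nonpos.2 (snd_lt_one hp hj h).le), neg_eq_zero.2 hj⟩
    simp [singleValuedPart, hj, harg]
  · have hpole : rotationNumber p = p.1 / (2 * π) * (poleIntegral p 1 + regularPart p (-1)) +
        (SignType.sign p.1 : ℝ) / 2 := by
      rw [rotationNumber_eq_poleIntegral hp hj,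
        poleIntegral_of_lt_xMinus hp (neg_one_lt_xMinus hp hj), sqrt_neg_P_neg_one]
      linear_combination div_mul_pi_div_abs hj
    linear_combination hpole - rotationNumber_eq_arg_neg hj

end SingleValuedPart

lemma continuousOn_singleValuedPart_of_xPlus_lt_one :
    ContinuousOn singleValuedPart (regularValues ∩ {p | xPlus p < 1}) := by
  have hpole := continuousOn_poleIntegral 1
  have hreg : ContinuousOn (fun p => regularPart p (-1)) (regularValues ∩ {p | xPlus p < 1}) :=
    continuousOn_regularPart_neg_one.mono inter_subset_left
  have harg : ContinuousOn (fun p => (-displacement p).arg)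
      (regularValues ∩ {p | xPlus p < 1}) := fun p hp =>
    ((Complex.continuousAt_arg (neg_displacement_mem_slitPlane hp.1 hp.2)).comp
      (f := fun p => -displacement p) (by fun_prop)).continuousWithinAt
  exact ContinuousOn.congr (by fun_prop) fun p hp => singleValuedPart_of_xPlus_lt_one hp.1 hp.2

lemma continuousOn_singleValuedPart_of_one_lt_xZero :
    ContinuousOn singleValuedPart (regularValues ∩ {p | 1 < xZero p}) := by
  have hreg₁ := continuousOn_regularPart 1
  have hreg₂ : ContinuousOn (fun p => regularPart p (-1)) (regularValues ∩ {p | 1 < xZero p}) :=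
    continuousOn_regularPart_neg_one.mono inter_subset_left
  have harg : ContinuousOn (fun p => (displacement p).arg)
      (regularValues ∩ {p | 1 < xZero p}) := fun p hp =>
    ((Complex.continuousAt_arg (displacement_mem_slitPlane hp.1 hp.2)).comp
      (f := displacement) (by fun_prop)).continuousWithinAt
  exact ContinuousOn.congr (by fun_prop) fun p hp => singleValuedPart_of_one_lt_xZero hp.1 hp.2

-- The pole `1` lies in `[x⁺, x⁰]`, so it stays away from `x⁺` or from `x⁰`.
lemma continuousAt_singleValuedPart {p : ℝ × ℝ} (hp : p ∈ regularValues) :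
    ContinuousAt singleValuedPart p := by
  rcases lt_or_ge (xPlus p) 1 with h | h
  · exact continuousOn_singleValuedPart_of_xPlus_lt_one.continuousAt
      ((continuousOn_xPlus.isOpen_inter_preimage isOpen_regularValues isOpen_Iio).mem_nhds ⟨hp, h⟩)
  · exact continuousOn_singleValuedPart_of_one_lt_xZero.continuousAt
      ((continuousOn_xZero.isOpen_inter_preimage isOpen_regularValues isOpen_Ioi).mem_nhds
        ⟨hp, h.trans_lt (xPlus_lt_xZero hp)⟩)

lemma continuousAt_rotationNumber {p : ℝ × ℝ} (hp : p ∈ regularValues) (hj : p.1 ≠ 0) :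
    ContinuousAt rotationNumber p := by
  have harg : ContinuousAt (fun q => (displacement q).arg) p :=
    (Complex.continuousAt_arg (Or.inr hj)).comp (f := displacement) (by fun_prop)
  have hsign : ContinuousAt (fun q : ℝ × ℝ => (SignType.sign q.1 : ℝ)) p :=
    (continuous_of_discreteTopology (f := fun s : SignType => (s : ℝ))).continuousAt.comp
      (f := fun q : ℝ × ℝ => SignType.sign q.1)
      ((continuousAt_sign_of_ne_zero hj).comp (f := Prod.fst) continuousAt_fst)
  have hne : ∀ᶠ q : ℝ × ℝ in 𝓝 p, q.1 ≠ 0 := continuousAt_fst.eventually_ne hj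
  exact (((continuousAt_singleValuedPart hp).sub (harg.div_const _)).add hsign).congr
    (hne.mono fun q hq => (rotationNumber_eq hq).symm)

section OneSidedLimits

variable {α : Type*} {l : Filter α} {c : α → ℝ × ℝ} {p : ℝ × ℝ} {s : SignType}

lemma tendsto_rotationNumber_of_one_lt (hp : p ∈ regularValues) (hj : p.1 = 0) (hh : 1 < p.2)
    (hc : Tendsto c l (𝓝 p)) (hs₀ : s ≠ 0) (hs : ∀ᶠ t in l, SignType.sign (c t).1 = s) :
    Tendsto (fun t => rotationNumber (c t)) l (𝓝 s) := by
  have hS : Tendsto (fun t => singleValuedPart (c t)) l (𝓝 0) := by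
    rw [← show singleValuedPart p = 0 from if_pos hj]
    exact (continuousAt_singleValuedPart hp).tendsto.comp hc
  have harg : Tendsto (fun t => (displacement (c t)).arg) l (𝓝 0) := by
    have h0 : (displacement p).arg = 0 := Complex.arg_eq_zero_iff.2 ⟨sub_nonneg.2 hh.le, hj⟩
    rw [← h0]
    exact (Complex.continuousAt_arg (Or.inl (sub_pos.2 hh))).tendsto.comp
      ((continuous_displacement.tendsto p).comp hc)
  have hlim := (hS.sub (harg.div_const (2 * π))).add_const (s : ℝ)
  rw [zero_div, sub_zero, zero_add] at hlim
  refine hlim.congr' (hs.mono fun t ht => ?_)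
  beta_reduce
  rw [rotationNumber_eq (sign_ne_zero.1 (ht ▸ hs₀)), ht]

lemma tendsto_rotationNumber_of_lt_one (hp : p ∈ regularValues) (hj : p.1 = 0) (hh : p.2 < 1)
    (hc : Tendsto c l (𝓝 p)) (hs₀ : s ≠ 0) (hs : ∀ᶠ t in l, SignType.sign (c t).1 = s) :
    Tendsto (fun t => rotationNumber (c t)) l (𝓝 (s / 2)) := by
  have hS : Tendsto (fun t => singleValuedPart (c t)) l (𝓝 0) := by
    rw [← show singleValuedPart p = 0 from if_pos hj]
    exact (continuousAt_singleValuedPart hp).tendsto.comp hc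
  have hre : 0 < (-displacement p).re := neg_pos.2 (sub_neg.2 hh)
  have harg : Tendsto (fun t => (-displacement (c t)).arg) l (𝓝 0) := by
    have h0 : (-displacement p).arg = 0 :=
      Complex.arg_eq_zero_iff.2 ⟨hre.le, neg_eq_zero.2 hj⟩
    rw [← h0]
    exact (Complex.continuousAt_arg (Or.inl hre)).tendsto.comp
      ((continuous_displacement.neg.tendsto p).comp hc)
  have hlim := (hS.sub (harg.div_const (2 * π))).add_const (s / 2 : ℝ)
  rw [zero_div, sub_zero, zero_add] at hlim
  refine hlim.congr' (hs.mono fun t ht => ?_)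
  beta_reduce
  rw [rotationNumber_eq_arg_neg (sign_ne_zero.1 (ht ▸ hs₀)), ht]

end OneSidedLimits

/-! ### Branches of the rotation number -/

lemma eq_intCast_of_dense {X : Type*} [TopologicalSpace X] [PreconnectedSpace X] [Nonempty X]
    {f : X → ℝ} (hf : Continuous f) {s : Set X} (hs : Dense s)
    (hfs : ∀ x ∈ s, ∃ n : ℤ, f x = n) : ∃ n : ℤ, ∀ x, f x = n := by
  have hclosed : IsClosed (range ((↑) : ℤ → ℝ)) := Int.isClosedEmbedding_coe_real.isClosed_range
  have hmem : ∀ x, f x ∈ range ((↑) : ℤ → ℝ) := fun x =>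
    (hclosed.preimage hf).closure_subset_iff.2
      (fun y hy => (hfs y hy).imp fun _ h => h.symm) (hs x)
  choose g hg using hmem
  have hgc : Continuous g :=
    Int.isClosedEmbedding_coe_real.isEmbedding.continuous_iff.2 (hf.congr fun x => (hg x).symm)
  obtain ⟨x₀⟩ := ‹Nonempty X›
  exact ⟨g x₀, fun x => by rw [← hg, PreconnectedSpace.constant inferInstance hgc]⟩

section Branches

variable {c : ℝ → ℝ × ℝ} {θ θ' φ : ℝ → ℝ}

lemma IsRotationBranch.sub_eq (hdense : Dense {t | (c t).1 ≠ 0}) (hθ : IsRotationBranch c θ)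
    (hθ' : IsRotationBranch c θ') (s t : ℝ) : θ s - θ t = θ' s - θ' t := by
  obtain ⟨n, hn⟩ := eq_intCast_of_dense (f := fun r => θ r - θ' r) (hθ.1.sub hθ'.1) hdense
    fun r hr => by
      obtain ⟨m, hm⟩ := hθ.2 r hr
      obtain ⟨m', hm'⟩ := hθ'.2 r hr
      exact ⟨m - m', by rw [hm, hm']; push_cast; ring⟩
  linear_combination hn s - hn t

lemma IsRotationBranch.exists_normalized {t₀ : ℝ} (hθ : IsRotationBranch c θ)
    (ht₀ : (c t₀).1 ≠ 0) : ∃ θ', IsRotationBranch c θ' ∧ θ' t₀ = rotationNumber (c t₀) := by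
  obtain ⟨n, hn⟩ := hθ.2 t₀ ht₀
  refine ⟨fun t => θ t - n, ⟨hθ.1.sub continuous_const, fun t ht => ?_⟩, sub_eq_of_eq_add hn⟩
  obtain ⟨m, hm⟩ := hθ.2 t ht
  exact ⟨m - n, by simp only [hm, Int.cast_sub]; ring⟩

lemma isRotationBranch_of_coe_eq_arg (hc : Continuous c) (hmem : ∀ t, c t ∈ regularValues)
    (hφ : Continuous φ)
    (harg : ∀ t, (φ t : Real.Angle) = ((displacement (c t)).arg : Real.Angle)) :
    IsRotationBranch c fun t => singleValuedPart (c t) - φ t / (2 * π) := by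
  have hS : Continuous fun t => singleValuedPart (c t) := continuous_iff_continuousAt.2 fun t =>
    (continuousAt_singleValuedPart (hmem t)).comp (f := c) hc.continuousAt
  refine ⟨hS.sub (hφ.div_const _), fun t ht => ?_⟩
  obtain ⟨k, hk⟩ := Real.Angle.angle_eq_iff_two_pi_dvd_sub.1 (harg t)
  refine ⟨-(SignType.sign (c t).1 : ℤ) - k, ?_⟩
  have hφt : φ t / (2 * π) = (displacement (c t)).arg / (2 * π) + k := by
    field_simp
    linear_combination hk
  simp only [rotationNumber_eq ht, hφt]
  push_cast
  ring

lemma IsRotationBranch.variation_eq (hθ : IsRotationBranch c θ) (hc : Continuous c)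
    (hmem : ∀ t, c t ∈ regularValues) (hdense : Dense {t | (c t).1 ≠ 0}) (hφ : Continuous φ)
    (harg : ∀ t, (φ t : Real.Angle) = ((displacement (c t)).arg : Real.Angle)) {s t : ℝ}
    (hst : c s = c t) : θ t - θ s = -(φ t - φ s) / (2 * π) := by
  rw [hθ.sub_eq hdense (isRotationBranch_of_coe_eq_arg hc hmem hφ harg), hst]
  ring

end Branches

/-! ### The circuit around the critical value -/

section Circuit

variable {ε : ℝ}

lemma circuit_zero (ε : ℝ) : circuit ε 0 = (ε, 1) := by simp [circuit]

lemma circuit_two_pi (ε : ℝ) : circuit ε (2 * π) = (ε, 1) := by simp [circuit]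

lemma reversedCircuit_zero (ε : ℝ) : reversedCircuit ε 0 = (ε, 1) := by
  simp [reversedCircuit, circuit]

lemma reversedCircuit_two_pi (ε : ℝ) : reversedCircuit ε (2 * π) = (ε, 1) := by
  simp [reversedCircuit, circuit]

lemma continuous_circuit (ε : ℝ) : Continuous (circuit ε) := by
  unfold circuit
  fun_prop

lemma continuous_reversedCircuit (ε : ℝ) : Continuous (reversedCircuit ε) :=
  (continuous_circuit ε).comp continuous_neg

lemma circuit_mem_regularValues (hε₀ : 0 < ε) (hε₁ : ε < 1) (t : ℝ) :
    circuit ε t ∈ regularValues := by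
  have hdist : (circuit ε t).1 ^ 2 + ((circuit ε t).2 - 1) ^ 2 = ε ^ 2 := by
    simp only [circuit]
    linear_combination ε ^ 2 * cos_sq_add_sin_sq t
  refine mem_regularValues_of_sq_add_sq_lt_one (fun h => ?_) ?_
  · simp [h, eq_comm, hε₀.ne'] at hdist
  · rw [hdist]
    exact pow_lt_one₀ hε₀.le hε₁ two_ne_zero

lemma dense_circuit_fst_ne_zero (hε : ε ≠ 0) : Dense {t | (circuit ε t).1 ≠ 0} := by
  have hcos : {t : ℝ | cos t = 0}.Countable :=
    (countable_range fun k : ℤ => (2 * (k : ℝ) + 1) * π / 2).mono fun t ht =>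
      (Real.cos_eq_zero_iff.1 ht).imp fun _ h => h.symm
  exact (hcos.dense_compl ℝ).mono fun t ht => mul_ne_zero hε ht

lemma dense_reversedCircuit_fst_ne_zero (hε : ε ≠ 0) :
    Dense {t | (reversedCircuit ε t).1 ≠ 0} := by
  simpa [reversedCircuit, circuit] using dense_circuit_fst_ne_zero hε

lemma displacement_circuit (ε t : ℝ) :
    displacement (circuit ε t) = ε * (↑(cos (π / 2 - t)) + ↑(sin (π / 2 - t)) * Complex.I) := by
  rw [cos_pi_div_two_sub, sin_pi_div_two_sub]
  apply Complex.ext <;>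
    simp [displacement, circuit, -Complex.ofReal_cos, -Complex.ofReal_sin]

lemma coe_eq_arg_displacement_circuit (hε : 0 < ε) (t : ℝ) :
    ((π / 2 - t : ℝ) : Real.Angle) = ((displacement (circuit ε t)).arg : Real.Angle) := by
  rw [displacement_circuit]
  exact (Complex.arg_mul_cos_add_sin_mul_I_coe_angle hε ((π / 2 - t : ℝ) : Real.Angle)).symm

lemma coe_eq_arg_displacement_reversedCircuit (hε : 0 < ε) (t : ℝ) :
    ((π / 2 + t : ℝ) : Real.Angle) =
      ((displacement (reversedCircuit ε t)).arg : Real.Angle) := by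
  rw [reversedCircuit, ← coe_eq_arg_displacement_circuit hε, sub_neg_eq_add]

lemma exists_isRotationBranch_circuit (hε₀ : 0 < ε) (hε₁ : ε < 1) :
    ∃ θ, IsRotationBranch (circuit ε) θ ∧ θ 0 = rotationNumber (ε, 1) := by
  rw [← circuit_zero ε]
  refine (isRotationBranch_of_coe_eq_arg (continuous_circuit ε)
    (circuit_mem_regularValues hε₀ hε₁) (by fun_prop)
    (coe_eq_arg_displacement_circuit hε₀)).exists_normalized ?_
  simpa [circuit_zero] using hε₀.ne'

lemma exists_isRotationBranch_reversedCircuit (hε₀ : 0 < ε) (hε₁ : ε < 1) :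
    ∃ θ, IsRotationBranch (reversedCircuit ε) θ ∧ θ 0 = rotationNumber (ε, 1) := by
  rw [← reversedCircuit_zero ε]
  refine (isRotationBranch_of_coe_eq_arg (continuous_reversedCircuit ε)
    (fun t => circuit_mem_regularValues hε₀ hε₁ (-t)) (by fun_prop)
    (coe_eq_arg_displacement_reversedCircuit hε₀)).exists_normalized ?_
  simpa [reversedCircuit_zero] using hε₀.ne'

lemma IsRotationBranch.variation_circuit (hε₀ : 0 < ε) (hε₁ : ε < 1) {θ : ℝ → ℝ}
    (hθ : IsRotationBranch (circuit ε) θ) : θ (2 * π) - θ 0 = 1 := by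
  rw [hθ.variation_eq (continuous_circuit ε) (circuit_mem_regularValues hε₀ hε₁)
    (dense_circuit_fst_ne_zero hε₀.ne') (by fun_prop) (coe_eq_arg_displacement_circuit hε₀)
    ((circuit_zero ε).trans (circuit_two_pi ε).symm)]
  field_simp
  ring

lemma IsRotationBranch.variation_reversedCircuit (hε₀ : 0 < ε) (hε₁ : ε < 1) {θ : ℝ → ℝ}
    (hθ : IsRotationBranch (reversedCircuit ε) θ) : θ (2 * π) - θ 0 = -1 := by
  rw [hθ.variation_eq (continuous_reversedCircuit ε)
    (fun t => circuit_mem_regularValues hε₀ hε₁ (-t)) (dense_reversedCircuit_fst_ne_zero hε₀.ne')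
    (by fun_prop) (coe_eq_arg_displacement_reversedCircuit hε₀)
    ((reversedCircuit_zero ε).trans (reversedCircuit_two_pi ε).symm)]
  field_simp
  ring

lemma continuous_returnTime_circuit (hε₀ : 0 < ε) (hε₁ : ε < 1) :
    Continuous fun t => returnTime (circuit ε t) :=
  continuousOn_returnTime.comp_continuous (continuous_circuit ε)
    (circuit_mem_regularValues hε₀ hε₁)

lemma continuousAt_rotationNumber_circuit (hε₀ : 0 < ε) (hε₁ : ε < 1) {t : ℝ}
    (ht : (circuit ε t).1 ≠ 0) : ContinuousAt (fun s => rotationNumber (circuit ε s)) t :=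
  (continuousAt_rotationNumber (circuit_mem_regularValues hε₀ hε₁ t) ht).comp
    (f := circuit ε) (continuous_circuit ε).continuousAt

lemma sign_circuit_fst (hε : 0 < ε) (t : ℝ) :
    SignType.sign (circuit ε t).1 = SignType.sign (cos t) := by
  rw [circuit, sign_mul, sign_pos hε, one_mul]

variable {t₀ : ℝ} {l : Filter ℝ} {s : SignType}

lemma tendsto_rotationNumber_circuit_of_sin_eq_one (hε₀ : 0 < ε) (hε₁ : ε < 1)
    (ht₀ : sin t₀ = 1) (hl : l ≤ 𝓝 t₀) (hs₀ : s ≠ 0)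
    (hs : ∀ᶠ t in l, SignType.sign (cos t) = s) :
    Tendsto (fun t => rotationNumber (circuit ε t)) l (𝓝 s) := by
  have hcos : cos t₀ = 0 := by simpa [ht₀] using sin_sq_add_cos_sq t₀
  refine tendsto_rotationNumber_of_one_lt (circuit_mem_regularValues hε₀ hε₁ t₀) ?_ ?_
    (((continuous_circuit ε).tendsto t₀).mono_left hl) hs₀
    (hs.mono fun t ht => (sign_circuit_fst hε₀ t).trans ht)
  · simp [circuit, hcos]
  · simpa [circuit, ht₀] using hε₀

lemma tendsto_rotationNumber_circuit_of_sin_eq_neg_one (hε₀ : 0 < ε) (hε₁ : ε < 1)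
    (ht₀ : sin t₀ = -1) (hl : l ≤ 𝓝 t₀) (hs₀ : s ≠ 0)
    (hs : ∀ᶠ t in l, SignType.sign (cos t) = s) :
    Tendsto (fun t => rotationNumber (circuit ε t)) l (𝓝 (s / 2)) := by
  have hcos : cos t₀ = 0 := by simpa [ht₀] using sin_sq_add_cos_sq t₀
  refine tendsto_rotationNumber_of_lt_one (circuit_mem_regularValues hε₀ hε₁ t₀) ?_ ?_
    (((continuous_circuit ε).tendsto t₀).mono_left hl) hs₀
    (hs.mono fun t ht => (sign_circuit_fst hε₀ t).trans ht)
  · simp [circuit, hcos]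
  · simpa [circuit, ht₀] using hε₀

end Circuit

section OneSidedLimitsCircuit

lemma sign_cos_of_mem_Ioo {t : ℝ} (ht : t ∈ Ioo (π / 2) (3 * π / 2)) :
    SignType.sign (cos t) = -1 :=
  sign_neg (cos_neg_of_pi_div_two_lt_of_lt ht.1 (by linarith [ht.2]))

lemma sin_three_pi_div_two : sin (3 * π / 2) = -1 := by
  rw [show 3 * π / 2 = π / 2 + π by ring, sin_add_pi, sin_pi_div_two]

variable {ε : ℝ}

lemma tendsto_rotationNumber_circuit_pi_div_two_left (hε₀ : 0 < ε) (hε₁ : ε < 1) :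
    Tendsto (fun t => rotationNumber (circuit ε t)) (𝓝[<] (π / 2)) (𝓝 1) := by
  have hcos : ∀ᶠ t in 𝓝[<] (π / 2), SignType.sign (cos t) = 1 :=
    mem_of_superset (Ioo_mem_nhdsLT (neg_lt_self pi_div_two_pos)) fun t ht =>
      sign_pos (cos_pos_of_mem_Ioo ht)
  simpa using tendsto_rotationNumber_circuit_of_sin_eq_one hε₀ hε₁ sin_pi_div_two
    nhdsWithin_le_nhds one_ne_zero hcos

lemma tendsto_rotationNumber_circuit_pi_div_two_right (hε₀ : 0 < ε) (hε₁ : ε < 1) :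
    Tendsto (fun t => rotationNumber (circuit ε t)) (𝓝[>] (π / 2)) (𝓝 (-1)) := by
  have hcos : ∀ᶠ t in 𝓝[>] (π / 2), SignType.sign (cos t) = -1 :=
    mem_of_superset (Ioo_mem_nhdsGT (by linarith [pi_pos])) fun t => sign_cos_of_mem_Ioo
  simpa using tendsto_rotationNumber_circuit_of_sin_eq_one hε₀ hε₁ sin_pi_div_two
    nhdsWithin_le_nhds (by decide) hcos

lemma tendsto_rotationNumber_circuit_three_pi_div_two_left (hε₀ : 0 < ε) (hε₁ : ε < 1) :
    Tendsto (fun t => rotationNumber (circuit ε t)) (𝓝[<] (3 * π / 2)) (𝓝 (-1 / 2)) := by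
  have hcos : ∀ᶠ t in 𝓝[<] (3 * π / 2), SignType.sign (cos t) = -1 :=
    mem_of_superset (Ioo_mem_nhdsLT (by linarith [pi_pos])) fun t => sign_cos_of_mem_Ioo
  simpa using tendsto_rotationNumber_circuit_of_sin_eq_neg_one hε₀ hε₁ sin_three_pi_div_two
    nhdsWithin_le_nhds (by decide) hcos

lemma tendsto_rotationNumber_circuit_three_pi_div_two_right (hε₀ : 0 < ε) (hε₁ : ε < 1) :
    Tendsto (fun t => rotationNumber (circuit ε t)) (𝓝[>] (3 * π / 2)) (𝓝 (1 / 2)) := by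
  have hcos : ∀ᶠ t in 𝓝[>] (3 * π / 2), SignType.sign (cos t) = 1 := by
    have hlt : 3 * π / 2 < 5 * π / 2 := by linarith [pi_pos]
    refine mem_of_superset (Ioo_mem_nhdsGT hlt) fun t ht => sign_pos ?_
    rw [← cos_sub_two_pi]
    exact cos_pos_of_mem_Ioo ⟨by linarith [ht.1], by linarith [ht.2]⟩
  simpa using tendsto_rotationNumber_circuit_of_sin_eq_neg_one hε₀ hε₁ sin_three_pi_div_two
    nhdsWithin_le_nhds one_ne_zero hcos

end OneSidedLimitsCircuit

/-! ### Monodromy of the period lattice -/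

section Lattice

lemma mem_periodLattice {p : ℝ × ℝ} {z : ℂ} :
    z ∈ periodLattice p ↔ ∃ m n : ℤ, z = m + n * tau p := by
  simp only [periodLattice, AddSubgroup.mem_closure_pair, zsmul_eq_mul, mul_one, eq_comm]

lemma tau_re (p : ℝ × ℝ) : (tau p).re = -rotationNumber p := by simp [tau]

lemma tau_im (p : ℝ × ℝ) : (tau p).im = returnTime p := by simp [tau]

variable {c : ℝ → ℝ × ℝ} {θ : ℝ → ℝ} {u : ℝ → ℂ}

lemma IsRotationBranch.isLatticeTransport (hθ : IsRotationBranch c θ)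
    (hT : Continuous fun t => returnTime (c t)) (m n : ℤ) :
    IsLatticeTransport c fun t => m + n * (-(θ t : ℂ) + Complex.I * (returnTime (c t) : ℂ)) := by
  have hcont := hθ.1
  refine ⟨by fun_prop, fun t ht => ?_⟩
  obtain ⟨k, hk⟩ := hθ.2 t ht
  refine mem_periodLattice.2 ⟨m - n * k, n, ?_⟩
  simp only [hk, tau]
  push_cast
  ring

-- The coefficient of `τ` is `im u / T`, an integer on a dense set, hence constant; then so is the
-- other coefficient, `re u + n θ`.
lemma IsLatticeTransport.exists_eq (hu : IsLatticeTransport c u)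
    (hdense : Dense {t | (c t).1 ≠ 0}) (hθ : IsRotationBranch c θ)
    (hT : Continuous fun t => returnTime (c t)) (hT₀ : ∀ t, returnTime (c t) ≠ 0) :
    ∃ m n : ℤ, ∀ t, u t = m + n * (-(θ t : ℂ) + Complex.I * (returnTime (c t) : ℂ)) := by
  obtain ⟨n, hn⟩ : ∃ n : ℤ, ∀ t, (u t).im / returnTime (c t) = n := by
    refine eq_intCast_of_dense ((Complex.continuous_im.comp hu.1).div hT hT₀) hdense
      fun t ht => ?_
    obtain ⟨m, n, hmn⟩ := mem_periodLattice.1 (hu.2 t ht)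
    exact ⟨n, (div_eq_iff (hT₀ t)).2 (by simp [hmn, tau_im])⟩
  have him : ∀ t, (u t).im = n * returnTime (c t) := fun t => (div_eq_iff (hT₀ t)).1 (hn t)
  obtain ⟨m, hm⟩ : ∃ m : ℤ, ∀ t, (u t).re + n * θ t = m := by
    refine eq_intCast_of_dense
      ((Complex.continuous_re.comp hu.1).add (continuous_const.mul hθ.1)) hdense fun t ht => ?_
    obtain ⟨m, n', hmn⟩ := mem_periodLattice.1 (hu.2 t ht)
    obtain ⟨k, hk⟩ := hθ.2 t ht
    have hn' : (n' : ℝ) = n :=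
      mul_right_cancel₀ (hT₀ t) (by rw [← him t, hmn]; simp [tau_im])
    refine ⟨m + n * k, ?_⟩
    have hre : (u t).re = m - n * rotationNumber (c t) := by
      rw [hmn, ← hn']
      simp [tau_re, sub_eq_add_neg]
    rw [hre, hk]
    push_cast
    ring
  refine ⟨m, n, fun t => Complex.ext ?_ ?_⟩
  · simp only [Complex.add_re, Complex.mul_re, Complex.neg_re, Complex.ofReal_re, Complex.I_re,
      Complex.I_im, Complex.ofReal_im, Complex.intCast_re, Complex.intCast_im]
    linear_combination hm t
  · simp [him t]

lemma IsLatticeTransport.apply_eq_sub (hu : IsLatticeTransport c u)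
    (hdense : Dense {t | (c t).1 ≠ 0}) (hθ : IsRotationBranch c θ)
    (hT : Continuous fun t => returnTime (c t)) (hT₀ : ∀ t, returnTime (c t) ≠ 0)
    {t₀ t₁ : ℝ} (hc : c t₀ = c t₁) {m₀ m₁ : ℤ} (hu₀ : u t₀ = m₀ + m₁ * tau (c t₀)) :
    u t₁ = u t₀ - m₁ * (θ t₁ - θ t₀ : ℝ) := by
  obtain ⟨m, n, hmn⟩ := hu.exists_eq hdense hθ hT hT₀
  have hn : m₁ = n := by
    have him := congrArg Complex.im (hu₀.symm.trans (hmn t₀))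
    simpa [tau_im, hT₀ t₀] using him
  rw [hmn t₁, hmn t₀, hc, hn]
  push_cast
  ring

lemma IsLatticeTransport.monodromy_reversedCircuit {ε : ℝ} (hε₀ : 0 < ε) (hε₁ : ε < 1)
    {m₀ m₁ : ℤ} (hu : IsLatticeTransport (reversedCircuit ε) u)
    (hu₀ : u 0 = m₀ + m₁ * tau (ε, 1)) : u (2 * π) = (m₀ + m₁ : ℤ) + m₁ * tau (ε, 1) := by
  obtain ⟨θ, hθ, -⟩ := exists_isRotationBranch_reversedCircuit hε₀ hε₁
  rw [hu.apply_eq_sub (dense_reversedCircuit_fst_ne_zero hε₀.ne') hθ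
    ((continuous_returnTime_circuit hε₀ hε₁).comp continuous_neg)
    (fun t => (returnTime_pos (circuit_mem_regularValues hε₀ hε₁ (-t))).ne')
    ((reversedCircuit_zero ε).trans (reversedCircuit_two_pi ε).symm)
    (by rw [reversedCircuit_zero, hu₀]), hθ.variation_reversedCircuit hε₀ hε₁, hu₀]
  push_cast
  ring

lemma exists_isLatticeTransport_reversedCircuit {ε : ℝ} (hε₀ : 0 < ε) (hε₁ : ε < 1)
    (m₀ m₁ : ℤ) :
    ∃ u, IsLatticeTransport (reversedCircuit ε) u ∧ u 0 = m₀ + m₁ * tau (ε, 1) := by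
  obtain ⟨θ, hθ, hθ₀⟩ := exists_isRotationBranch_reversedCircuit hε₀ hε₁
  refine ⟨_, hθ.isLatticeTransport
    ((continuous_returnTime_circuit hε₀ hε₁).comp continuous_neg) m₀ m₁, ?_⟩
  simp only [hθ₀, reversedCircuit_zero, tau]

end Lattice

end SphericalPendulum

end

theorem proposition7 :
    ∃ ε₀ : ℝ, 0 < ε₀ ∧
      -- `T` is a continuous single-valued function on the punctured disc of radius `ε₀`
      ContinuousOn SphericalPendulum.returnTime
        {p : ℝ × ℝ | p ≠ (0, 1) ∧ p.1 ^ 2 + (p.2 - 1) ^ 2 < ε₀ ^ 2} ∧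
      ∀ ε : ℝ, 0 < ε → ε < ε₀ →
        -- the roots, and the convergence of the integrals
        (∀ t : ℝ,
          -1 ≤ SphericalPendulum.xMinus (SphericalPendulum.circuit ε t) ∧
          SphericalPendulum.xMinus (SphericalPendulum.circuit ε t)
            < SphericalPendulum.xPlus (SphericalPendulum.circuit ε t) ∧
          SphericalPendulum.xPlus (SphericalPendulum.circuit ε t) ≤ 1 ∧
          1 ≤ SphericalPendulum.xZero (SphericalPendulum.circuit ε t) ∧
          SphericalPendulum.xPlus (SphericalPendulum.circuit ε t)
            < SphericalPendulum.xZero (SphericalPendulum.circuit ε t) ∧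
          (∀ x : ℝ, SphericalPendulum.P (SphericalPendulum.circuit ε t) x =
            2 * (x - SphericalPendulum.xMinus (SphericalPendulum.circuit ε t))
              * (x - SphericalPendulum.xPlus (SphericalPendulum.circuit ε t))
              * (x - SphericalPendulum.xZero (SphericalPendulum.circuit ε t))) ∧
          IntervalIntegrable
            (fun x => 1 / √(SphericalPendulum.P (SphericalPendulum.circuit ε t) x))
            MeasureTheory.volume
            (SphericalPendulum.xMinus (SphericalPendulum.circuit ε t))
            (SphericalPendulum.xPlus (SphericalPendulum.circuit ε t)) ∧
          ((SphericalPendulum.circuit ε t).1 ≠ 0 →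
            IntervalIntegrable
              (fun x => 1 / ((1 - x ^ 2) * √(SphericalPendulum.P (SphericalPendulum.circuit ε t) x)))
              MeasureTheory.volume
              (SphericalPendulum.xMinus (SphericalPendulum.circuit ε t))
              (SphericalPendulum.xPlus (SphericalPendulum.circuit ε t))) ∧
          0 < SphericalPendulum.returnTime (SphericalPendulum.circuit ε t)) ∧
        -- `T` is continuous along the circuit and returns to its initial value
        (Continuous (fun t => SphericalPendulum.returnTime (SphericalPendulum.circuit ε t)) ∧
          SphericalPendulum.returnTime (SphericalPendulum.circuit ε (2 * Real.pi)) =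
            SphericalPendulum.returnTime (SphericalPendulum.circuit ε 0)) ∧
        -- the integral `Θ` is continuous along the circuit except for the jumps
        -- `1 → -1` at `t = π/2` and `-1/2 → 1/2` at `t = 3π/2`, which add up to `-1`
        (∀ t : ℝ, (SphericalPendulum.circuit ε t).1 ≠ 0 →
          ContinuousAt
            (fun s => SphericalPendulum.rotationNumber (SphericalPendulum.circuit ε s)) t) ∧
        Filter.Tendsto (fun t => SphericalPendulum.rotationNumber (SphericalPendulum.circuit ε t))
          (𝓝[<] (Real.pi / 2)) (𝓝 1) ∧
        Filter.Tendsto (fun t => SphericalPendulum.rotationNumber (SphericalPendulum.circuit ε t))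
          (𝓝[>] (Real.pi / 2)) (𝓝 (-1)) ∧
        Filter.Tendsto (fun t => SphericalPendulum.rotationNumber (SphericalPendulum.circuit ε t))
          (𝓝[<] (3 * Real.pi / 2)) (𝓝 (-1 / 2)) ∧
        Filter.Tendsto (fun t => SphericalPendulum.rotationNumber (SphericalPendulum.circuit ε t))
          (𝓝[>] (3 * Real.pi / 2)) (𝓝 (1 / 2)) ∧
        -- a continuous branch of `Θ` exists; it varies by `-1` along the circuit with `(h, j)`
        -- positively oriented, hence by `+1` when the circuit is run the other way
        (∃ θ : ℝ → ℝ,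
          SphericalPendulum.IsRotationBranch (SphericalPendulum.reversedCircuit ε) θ ∧
          θ 0 = SphericalPendulum.rotationNumber (ε, 1)) ∧
        (∀ θ : ℝ → ℝ,
          SphericalPendulum.IsRotationBranch (SphericalPendulum.reversedCircuit ε) θ →
          θ (2 * Real.pi) - θ 0 = -1) ∧
        (∃ θ : ℝ → ℝ,
          SphericalPendulum.IsRotationBranch (SphericalPendulum.circuit ε) θ ∧
          θ 0 = SphericalPendulum.rotationNumber (ε, 1)) ∧
        (∀ θ : ℝ → ℝ,
          SphericalPendulum.IsRotationBranch (SphericalPendulum.circuit ε) θ →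
          θ (2 * Real.pi) - θ 0 = 1) ∧
        -- monodromy of the lattices `ℤ + ℤ τ`: the basis `(1, τ)` returns as `(1, τ + 1)`
        (∀ m : Fin 2 → ℤ, ∃ u : ℝ → ℂ,
          SphericalPendulum.IsLatticeTransport (SphericalPendulum.reversedCircuit ε) u ∧
          u 0 = (m 0 : ℂ) + (m 1 : ℂ) * SphericalPendulum.tau (ε, 1)) ∧
        (∀ (u : ℝ → ℂ) (m : Fin 2 → ℤ),
          SphericalPendulum.IsLatticeTransport (SphericalPendulum.reversedCircuit ε) u →
          u 0 = (m 0 : ℂ) + (m 1 : ℂ) * SphericalPendulum.tau (ε, 1) →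
          u (2 * Real.pi) =
            (((!![1, 1; 0, 1] : Matrix (Fin 2) (Fin 2) ℤ) *ᵥ m) 0 : ℂ) +
              (((!![1, 1; 0, 1] : Matrix (Fin 2) (Fin 2) ℤ) *ᵥ m) 1 : ℂ) *
                SphericalPendulum.tau (ε, 1)) := by
  refine ⟨1, one_pos, SphericalPendulum.continuousOn_returnTime.mono fun p hp =>
    SphericalPendulum.mem_regularValues_of_sq_add_sq_lt_one hp.1 (by simpa using hp.2),
    fun ε hε₀ hε₁ => ?_⟩
  have hreg := SphericalPendulum.circuit_mem_regularValues hε₀ hε₁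
  exact ⟨fun t => ⟨SphericalPendulum.neg_one_le_xMinus (hreg t),
      SphericalPendulum.xMinus_lt_xPlus (hreg t), SphericalPendulum.xPlus_le_one (hreg t),
      SphericalPendulum.one_le_xZero (hreg t), SphericalPendulum.xPlus_lt_xZero (hreg t),
      SphericalPendulum.P_eq_mul (hreg t),
      SphericalPendulum.intervalIntegrable_div_sqrt_P (hreg t) continuousOn_const,
      SphericalPendulum.intervalIntegrable_one_div_one_sub_sq_mul_sqrt_P (hreg t),
      SphericalPendulum.returnTime_pos (hreg t)⟩,
    ⟨SphericalPendulum.continuous_returnTime_circuit hε₀ hε₁, by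
      rw [SphericalPendulum.circuit_two_pi, SphericalPendulum.circuit_zero]⟩,
    fun t => SphericalPendulum.continuousAt_rotationNumber_circuit hε₀ hε₁,
    SphericalPendulum.tendsto_rotationNumber_circuit_pi_div_two_left hε₀ hε₁,
    SphericalPendulum.tendsto_rotationNumber_circuit_pi_div_two_right hε₀ hε₁,
    SphericalPendulum.tendsto_rotationNumber_circuit_three_pi_div_two_left hε₀ hε₁,
    SphericalPendulum.tendsto_rotationNumber_circuit_three_pi_div_two_right hε₀ hε₁,
    SphericalPendulum.exists_isRotationBranch_reversedCircuit hε₀ hε₁,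
    fun θ hθ => hθ.variation_reversedCircuit hε₀ hε₁,
    SphericalPendulum.exists_isRotationBranch_circuit hε₀ hε₁,
    fun θ hθ => hθ.variation_circuit hε₀ hε₁,
    fun m => SphericalPendulum.exists_isLatticeTransport_reversedCircuit hε₀ hε₁ (m 0) (m 1),
    fun u m hu hu₀ => by
      simpa [Matrix.mulVec, dotProduct, Fin.sum_univ_two]
        using hu.monodromy_reversedCircuit hε₀ hε₁ hu₀⟩
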